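/- Let $\xi$ be a probability distribution on $\mathbb{Z}$ which is symmetric ($\mathbb{P}(\xi=-k)=\mathbb{P}(\xi=k)$ for all $k$), aperiodic (the set $\{k:\mathbb{P}(\xi=k)>0\}$ generates the group $\mathbb{Z}$), has finite variance, $\mathbb{E}|\xi|^2<\infty$, and allows arbitrarily long jumps ($\mathbb{P}(|\xi|>m)>0$ for every $m\in\mathbb{N}$). Let $R=(R_0,R_1,\dots)$ be the random walk on $\mathbb{Z}$ with i.i.d. steps distributed as $\xi$, and for a finite nonempty $A\subset\mathbb{Z}$ let $T_A=\min\{n>0: R_n\in A\}$. Let $\mathbb{P}^A_{+\infty}$ (respectively $\mathbb{P}^A_{-\infty}$) be the probability measure on paths $(\gamma_i)_{i\le 0}$ in $\mathbb{Z}$ which is the limit, as $y\to+\infty$ (respectively $y\to-\infty$), in the sense of finite-dimensional distributions, of the law of $(R_{T_A+i})_{i\le 0}$ for the walk started at $R_0=y$, and let $\mathbb{P}^A_\infty=\frac12(\mathbb{P}^A_{+\infty}+\mathbb{P}^A_{-\infty})$. The one-dimensional DLA process with paths with respect to $R$ is the sequence of random paths $\Pi_1,\Pi_2,\dots$ and aggregates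 $A_0\subset A_1\subset\cdots$ such that $A_0=\{0\}$ and, for every $n\ge 0$, conditionally on $\Pi_1,\dots,\Pi_n$ the path $\Pi_{n+1}=(\Pi_{n+1}(i))_{i\le 0}$ has law $\mathbb{P}^{A_n}_\infty$, and $A_{n+1}=A_n\cup\{\Pi_{n+1}(-1)\}$. The aggregation tree $\tau_n$ is the graph with vertex set $A_n$ and edge set $\{\{\Pi_i(0),\Pi_i(-1)\}: 1\le i\le n\}$, and the limit aggregation tree is $\tau_\infty=\bigcup_{n\ge0}\tau_n$. Then, almost surely, $$\sup_{v\in\tau_\infty}\deg_{\tau_\infty}(v)=\infty .$$ -/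

import Mathlib

open MeasureTheory ProbabilityTheory Filter Topology
open scoped ENNReal

namespace DLA

noncomputable section

/-! ### The random walk

The step distribution is a probability measure `ξ` on `ℤ`; a point `s : ℕ → ℤ` of the sample space
of the walk is the sequence of its steps, which are independent with law `ξ`. -/

/-- The step distribution is symmetric. -/
def IsSymmetric (ξ : Measure ℤ) : Prop :=
  ∀ k : ℤ, ξ {-k} = ξ {k}

/-- The walk is aperiodic: the possible steps generate the additive group `ℤ`
(and not a proper subgroup). -/
def IsAperiodic (ξ : Measure ℤ) : Prop :=
  AddSubgroup.closure {k : ℤ | 0 < ξ {k}} = ⊤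

/-- `E |ξ|² < ∞`. -/
def HasFiniteVariance (ξ : Measure ℤ) : Prop :=
  Integrable (fun k : ℤ => (k : ℝ) ^ 2) ξ

/-- The walk makes arbitrarily long jumps: the steps are not bounded by a constant. -/
def HasUnboundedSteps (ξ : Measure ℤ) : Prop :=
  ∀ m : ℕ, 0 < ξ {k : ℤ | (m : ℤ) < |k|}

/-- The law of a sequence of independent steps, each with distribution `ξ`. -/
def stepLaw (ξ : Measure ℤ) [IsProbabilityMeasure ξ] : Measure (ℕ → ℤ) :=
  Measure.infinitePi fun _ : ℕ => ξ

/-- The position `R_k` of the walk started at `y` with steps `s`. -/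
def walk (y : ℤ) (s : ℕ → ℤ) (k : ℕ) : ℤ :=
  y + ∑ i ∈ Finset.range k, s i

/-- `T` is the hitting time `T_A = min {k > 0 : R_k ∈ A}` of the walk started at `y`. -/
def IsHittingTime (A : Finset ℤ) (y : ℤ) (s : ℕ → ℤ) (T : ℕ) : Prop :=
  0 < T ∧ walk y s T ∈ A ∧ ∀ k, 0 < k → k < T → walk y s k ∉ A

/-! ### Paths from infinity

A backward infinite path `Π(0), Π(-1), Π(-2), …` is represented by `γ : ℕ → ℤ`, `γ i = Π(-i)`. -/

/-- The paths `γ` with `γ i = x i` for `i ≤ m`. -/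
def cylinder (m : ℕ) (x : ℕ → ℤ) : Set (ℕ → ℤ) :=
  {γ | ∀ i ≤ m, γ i = x i}

/-- The event that the walk started at `y` hits `A` at a time `T_A ≥ m` and that
`R_{T_A - i} = x i` for `0 ≤ i ≤ m`. -/
def hittingEvent (A : Finset ℤ) (y : ℤ) (m : ℕ) (x : ℕ → ℤ) : Set (ℕ → ℤ) :=
  {s | ∃ T, IsHittingTime A y s T ∧ m ≤ T ∧ ∀ i ≤ m, walk y s (T - i) = x i}

/-- `ν` is the limit, as the starting point `y` tends to infinity along `l`, of the law of
`(R_{T_A - i})_{i ≥ 0}` for the walk started at `y`: the finite-dimensional distributions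
converge to those of the probability measure `ν`. -/
structure IsLimitPathLaw (ξ : Measure ℤ) [IsProbabilityMeasure ξ] (A : Finset ℤ) (l : Filter ℤ)
    (ν : Measure (ℕ → ℤ)) : Prop where
  isProbabilityMeasure : IsProbabilityMeasure ν
  tendsto : ∀ (m : ℕ) (x : ℕ → ℤ),
    Tendsto (fun y : ℤ => stepLaw ξ (hittingEvent A y m x)) l (𝓝 (ν (cylinder m x)))

open Classical in
/-- The limit law itself (`P_{+∞}` for `l = atTop`, `P_{-∞}` for `l = atBot`); it is unique when it
exists, see `IsLimitPathLaw.unique`, and the zero measure is used when it does not exist. -/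
def limitPathLaw (ξ : Measure ℤ) [IsProbabilityMeasure ξ] (A : Finset ℤ) (l : Filter ℤ) :
    Measure (ℕ → ℤ) :=
  if h : ∃ ν, IsLimitPathLaw ξ A l ν then h.choose else 0

/-- `P_∞ = (P_{+∞} + P_{-∞}) / 2`, with respect to the set `A`. -/
def pathLaw (ξ : Measure ℤ) [IsProbabilityMeasure ξ] (A : Finset ℤ) : Measure (ℕ → ℤ) :=
  (2⁻¹ : ℝ≥0∞) • (limitPathLaw ξ A atTop + limitPathLaw ξ A atBot)

theorem measurableSet_cylinder (m : ℕ) (x : ℕ → ℤ) : MeasurableSet (cylinder m x) := by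
  have h : cylinder m x = ⋂ i ∈ Finset.range (m + 1), (fun γ : ℕ → ℤ => γ i) ⁻¹' {x i} := by
    ext γ
    simp [cylinder]
  rw [h]
  exact Finset.measurableSet_biInter _ fun i _ =>
    measurable_pi_apply i (measurableSet_singleton (x i))

theorem generateFrom_cylinder :
    (inferInstance : MeasurableSpace (ℕ → ℤ)) =
      MeasurableSpace.generateFrom {S | ∃ m x, S = cylinder m x} := by
  apply le_antisymm
  · change MeasurableSpace.pi ≤ _
    refine iSup_le fun i => ?_
    rw [← measurable_iff_comap_le]
    refine @measurable_to_countable' ℤ (ℕ → ℤ) _ _ (_) _ fun k => ?_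
    have h : (fun γ : ℕ → ℤ => γ i) ⁻¹' {k} =
        ⋃ x : Fin i → ℤ, cylinder i (fun j => if hj : j < i then x ⟨j, hj⟩ else k) := by
      ext γ
      simp only [Set.mem_preimage, Set.mem_singleton_iff, Set.mem_iUnion, cylinder,
        Set.mem_ofPred_eq]
      constructor
      · intro hk
        refine ⟨fun j => γ j, fun j hj => ?_⟩
        split_ifs with h
        · rfl
        · rw [← hk, le_antisymm hj (not_lt.mp h)]
      · rintro ⟨x, hx⟩
        simpa using hx i le_rfl
    rw [h]
    exact MeasurableSet.iUnion fun x => MeasurableSpace.measurableSet_generateFrom ⟨_, _, rfl⟩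
  · refine MeasurableSpace.generateFrom_le ?_
    rintro _ ⟨m, x, rfl⟩
    exact measurableSet_cylinder m x

theorem isPiSystem_cylinder : IsPiSystem {S | ∃ m x, S = cylinder m x} := by
  rintro _ ⟨m, x, rfl⟩ _ ⟨n, z, rfl⟩ ⟨γ, hγ, hγ'⟩
  refine ⟨max m n, γ, ?_⟩
  ext δ
  simp only [cylinder, Set.mem_inter_iff, Set.mem_ofPred_eq] at hγ hγ' ⊢
  constructor
  · rintro ⟨h, h'⟩ i hi
    rcases le_max_iff.mp hi with hi | hi
    · rw [h i hi, hγ i hi]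
    · rw [h' i hi, hγ' i hi]
  · intro h
    exact ⟨fun i hi => by rw [h i (hi.trans (le_max_left _ _)), hγ i hi],
      fun i hi => by rw [h i (hi.trans (le_max_right _ _)), hγ' i hi]⟩

theorem IsLimitPathLaw.unique {ξ : Measure ℤ} [IsProbabilityMeasure ξ] {A : Finset ℤ}
    {l : Filter ℤ} [l.NeBot] {ν ν' : Measure (ℕ → ℤ)} (h : IsLimitPathLaw ξ A l ν)
    (h' : IsLimitPathLaw ξ A l ν') : ν = ν' := by
  have := h.isProbabilityMeasure
  have := h'.isProbabilityMeasure
  refine ext_of_generate_finite _ generateFrom_cylinder isPiSystem_cylinder ?_ (by simp)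
  rintro _ ⟨m, x, rfl⟩
  exact tendsto_nhds_unique (h.tendsto m x) (h'.tendsto m x)

theorem limitPathLaw_eq {ξ : Measure ℤ} [IsProbabilityMeasure ξ] {A : Finset ℤ}
    {l : Filter ℤ} [l.NeBot] {ν : Measure (ℕ → ℤ)} (h : IsLimitPathLaw ξ A l ν) :
    limitPathLaw ξ A l = ν := by
  have hex : ∃ ν, IsLimitPathLaw ξ A l ν := ⟨ν, h⟩
  rw [limitPathLaw, dif_pos hex]
  exact hex.choose_spec.unique h

/-! ### The aggregation process

The path `Π_{n+1}` of the `(n+1)`-st particle is the random variable `path n`, so that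
`path n ω i = Π_{n+1}(-i)`. -/

variable {Ω : Type*}

/-- The aggregate `A_n = {0, Π_1(-1), …, Π_n(-1)}`. -/
def aggregate (path : ℕ → Ω → ℕ → ℤ) (n : ℕ) (ω : Ω) : Finset ℤ :=
  insert 0 ((Finset.range n).image fun i => path i ω 1)

/-- The σ-algebra `ℱ_n` generated by `Π_1, …, Π_n`. -/
@[reducible] def history (path : ℕ → Ω → ℕ → ℤ) (n : ℕ) : MeasurableSpace Ω :=
  ⨆ i ∈ Finset.range n, MeasurableSpace.comap (path i) inferInstance

/-- `path` is the DLA process with paths with respect to the walk with step distribution `ξ`: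
given `Π_1, …, Π_n`, the path `Π_{n+1}` is chosen according to `P_∞` with respect to `A_n`. -/
structure IsDLA (ξ : Measure ℤ) [IsProbabilityMeasure ξ] [MeasurableSpace Ω] (μ : Measure Ω)
    (path : ℕ → Ω → ℕ → ℤ) : Prop where
  measurable : ∀ n, Measurable (path n)
  condLaw : ∀ (n : ℕ) (S : Set (ℕ → ℤ)), MeasurableSet S →
    μ⟦path n ⁻¹' S | history path n⟧ =ᵐ[μ] fun ω => (pathLaw ξ (aggregate path n ω)).real S

/-! ### The aggregation tree -/

/-- The aggregation tree `τ_n`: its vertices are the points of `A_n`, and its edges join `Π_i(0)`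
and `Π_i(-1)`, `i ≤ n`. (Almost surely `Π_i(0) ≠ Π_i(-1)` and both points belong to `A_n`.) -/
def aggregationTree (path : ℕ → Ω → ℕ → ℤ) (n : ℕ) (ω : Ω) : (⊤ : SimpleGraph ℤ).Subgraph where
  verts := aggregate path n ω
  Adj u v := u ≠ v ∧ u ∈ aggregate path n ω ∧ v ∈ aggregate path n ω ∧
    ∃ i < n, s(u, v) = s(path i ω 0, path i ω 1)
  adj_sub h := h.1
  edge_vert h := h.2.1
  symm := ⟨fun _ _ h => ⟨h.1.symm, h.2.2.1, h.2.1, by rw [Sym2.eq_swap]; exact h.2.2.2⟩⟩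

/-- The limit aggregation tree `τ_∞ = ⋃ τ_n`. -/
def limitTree (path : ℕ → Ω → ℕ → ℤ) (ω : Ω) : (⊤ : SimpleGraph ℤ).Subgraph :=
  ⨆ n, aggregationTree path n ω

end

end DLA

/-!
The mechanism is that a particle coming from `+∞` may jump over everything glued so far onto one
fixed point `v`, and that this has a probability which does not depend on the aggregate.

Let `v = max A_n` and let `0 < j 0 < j 1 < …` be lengths of steps of positive probability; there are
infinitely many, since the steps are unbounded. Suppose that the next particles have been glued to
`v` from `v + j 0`, …, `v + j (i - 1)`. Then `w = v + j i` lies to the right of the aggregate, and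
the walk from a far point `y` certainly hits the aggregate at `v` coming from `w` if it enters
`(-∞, w]` exactly at `w` and jumps to `v` in the next step. The probability of this is
`entryProb ξ (y - w) * ξ {v - w}` (`entryProb_mul_le_stepLaw_hittingEvent`). Along the `y` for which
`entryProb` is at least a constant `c > 0` it bounds the limit law from below
(`IsLimitPathLaw.le_cylinder`), so that the next gluing takes place from `w` to `v` with conditional
probability at least `c * ξ {v - w} / 2`. Therefore each block of `k` particles forms a star with
`k` leaves around the largest point of the aggregate with a conditional probability bounded away
from `0` (`IsDLA.le_measure_inter_star`), and almost surely some block does so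
(`IsDLA.ae_exists_mem_star`).

It remains to see that `entryProb ξ y`, the probability of entering `(-∞, 0]` without overshoot from
`y`, does not tend to `0` as `y → ∞` (`exists_frequently_le_entryProb`). This is where the finite
variance is used. Let `green ξ y z` be the expected number of visits to `z` before the entrance into
`(-∞, 0]`. Decomposing paths according to their minimum, and using the symmetry of the Green
function, one finds that `green ξ y z` is at most a constant times the sum of `entryProb ξ (y - m)`
over `1 ≤ m ≤ z` (`green_le_sum`). On the other hand the sum of `green ξ y z * ξ (Iic (-z))` over
`z` is the probability of ever entering `(-∞, 0]`, which is at least `1 / 2` by symmetry because the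
walk leaves every bounded interval. As the sum of `z * ξ (Iic (-z))` is finite, dominated
convergence would make this probability tend to `0` if `entryProb` did.
-/

namespace DLA

/-! ### The walk killed on leaving the positive half-line -/

section Green


/-- The probability that the walk started at `y` is at `z` at time `n` and is positive at all the
times `0, …, n`. -/
noncomputable def stayWeight (ξ : Measure ℤ) : ℕ → ℤ → ℤ → ℝ≥0∞
  | 0, y, z => if 0 < y ∧ y = z then 1 else 0
  | n + 1, y, z => if 0 < y then ∑' w, ξ {w - y} * stayWeight ξ n w z else 0

/-- The Green function of the walk killed on leaving the positive half-line: the expected number of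
visits to `z` before the first entrance into `(-∞, 0]`, for the walk started at `y`. -/
noncomputable def green (ξ : Measure ℤ) (y z : ℤ) : ℝ≥0∞ := ∑' n, stayWeight ξ n y z

/-- The probability that the walk started at `a` enters `(-∞, 0]` for the first time at time `n`,
and does so at the point `0`; time `0` counts as an entrance. -/
noncomputable def entryWeight (ξ : Measure ℤ) : ℕ → ℤ → ℝ≥0∞
  | 0, a => if a = 0 then 1 else 0
  | n + 1, a => if 0 < a then ∑' w, ξ {w - a} * entryWeight ξ n w else 0

/-- The probability that the walk started at `a` enters `(-∞, 0]` exactly at `0`, that is, without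
overshoot. -/
noncomputable def entryProb (ξ : Measure ℤ) (a : ℤ) : ℝ≥0∞ := ∑' n, entryWeight ξ n a

theorem stayWeight_eq_zero_of_start_nonpos (ξ : Measure ℤ) (n : ℕ) {y : ℤ} (hy : y ≤ 0) (z : ℤ) :
    stayWeight ξ n y z = 0 := by
  cases n <;> simp [stayWeight, hy.not_gt]

theorem stayWeight_succ_right (ξ : Measure ℤ) (n : ℕ) (y z : ℤ) :
    stayWeight ξ (n + 1) y z =
      if 0 < z then ∑' w, stayWeight ξ n y w * ξ {z - w} else 0 := by
  induction n generalizing y with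
  | zero =>
    have h₁ : ∀ w : ℤ, w ≠ z → ξ {w - y} * stayWeight ξ 0 w z = 0 := fun w hw => by
      simp [stayWeight, hw]
    have h₂ : ∀ w : ℤ, w ≠ y → stayWeight ξ 0 y w * ξ {z - w} = 0 := fun w hw => by
      simp [stayWeight, hw.symm]
    rw [stayWeight, tsum_eq_single z h₁, tsum_eq_single y h₂]
    by_cases hy : 0 < y <;> by_cases hz : 0 < z <;> simp [stayWeight, hy, hz]
  | succ n ih =>
    rw [stayWeight]
    simp_rw [ih]
    by_cases hy : 0 < y <;> by_cases hz : 0 < z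
    · simp only [hy, hz, if_true, stayWeight, ← ENNReal.tsum_mul_left, ← ENNReal.tsum_mul_right]
      rw [ENNReal.tsum_comm]
      simp only [mul_assoc]
    · simp [hz]
    · simp [hy, stayWeight]
    · simp [hy, hz]

theorem IsSymmetric.apply_sub_comm {ξ : Measure ℤ} (hsymm : IsSymmetric ξ) (a b : ℤ) :
    ξ {a - b} = ξ {b - a} := by
  rw [← hsymm (b - a), neg_sub]

theorem stayWeight_comm {ξ : Measure ℤ} (hsymm : IsSymmetric ξ) (n : ℕ) (y z : ℤ) :
    stayWeight ξ n y z = stayWeight ξ n z y := by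
  induction n generalizing y z with
  | zero =>
    by_cases h : y = z
    · subst h; rfl
    · simp [stayWeight, h, Ne.symm h]
  | succ n ih =>
    rw [stayWeight_succ_right, stayWeight]
    congr 1
    exact tsum_congr fun w => by rw [ih, hsymm.apply_sub_comm, mul_comm]

theorem green_comm {ξ : Measure ℤ} (hsymm : IsSymmetric ξ) (y z : ℤ) :
    green ξ y z = green ξ z y :=
  tsum_congr fun n => stayWeight_comm hsymm n y z

theorem green_eq_zero_of_start_nonpos (ξ : Measure ℤ) {y : ℤ} (hy : y ≤ 0) (z : ℤ) :
    green ξ y z = 0 := by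
  simp [green, stayWeight_eq_zero_of_start_nonpos ξ _ hy]

theorem green_eq_zero_of_end_nonpos {ξ : Measure ℤ} (hsymm : IsSymmetric ξ) (y : ℤ) {z : ℤ}
    (hz : z ≤ 0) : green ξ y z = 0 := by
  rw [green_comm hsymm, green_eq_zero_of_start_nonpos ξ hz]

theorem green_eq (ξ : Measure ℤ) {y : ℤ} (hy : 0 < y) (z : ℤ) :
    green ξ y z = (if y = z then 1 else 0) + ∑' w, ξ {w - y} * green ξ w z := by
  rw [green, tsum_eq_zero_add' ENNReal.summable]
  simp only [stayWeight, hy, true_and, if_true, green, ← ENNReal.tsum_mul_left]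
  rw [ENNReal.tsum_comm]

theorem entryProb_zero (ξ : Measure ℤ) : entryProb ξ 0 = 1 := by
  rw [entryProb, tsum_eq_zero_add' ENNReal.summable]
  simp [entryWeight]

theorem entryProb_of_neg (ξ : Measure ℤ) {a : ℤ} (ha : a < 0) : entryProb ξ a = 0 := by
  rw [entryProb, tsum_eq_zero_add' ENNReal.summable]
  simp [entryWeight, ha.not_gt, ha.ne]

theorem entryProb_of_pos (ξ : Measure ℤ) {a : ℤ} (ha : 0 < a) :
    entryProb ξ a = ∑' w, ξ {w - a} * entryProb ξ w := by
  rw [entryProb, tsum_eq_zero_add' ENNReal.summable]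
  simp only [entryWeight, ha, ha.ne', if_true, if_false, zero_add, entryProb,
    ← ENNReal.tsum_mul_left]
  rw [ENNReal.tsum_comm]

theorem tsum_step (ξ : Measure ℤ) [IsProbabilityMeasure ξ] (y : ℤ) :
    ∑' w, ξ {w - y} = 1 := by
  rw [← measure_univ (μ := ξ), ← lintegral_one, lintegral_countable',
    ← (Equiv.subRight y).tsum_eq (fun k => 1 * ξ {k})]
  simp

theorem sum_range_succ_entryWeight (ξ : Measure ℤ) (N : ℕ) {a : ℤ} (ha : 0 < a) :
    ∑ n ∈ Finset.range (N + 1), entryWeight ξ n a =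
      ∑' w, ξ {w - a} * ∑ n ∈ Finset.range N, entryWeight ξ n w := by
  rw [Finset.sum_range_succ']
  simp only [entryWeight, ha, ha.ne', if_true, if_false, add_zero, Finset.mul_sum]
  rw [Summable.tsum_finsetSum fun _ _ => ENNReal.summable]

theorem entryProb_le_one (ξ : Measure ℤ) [IsProbabilityMeasure ξ] (a : ℤ) :
    entryProb ξ a ≤ 1 := by
  rcases lt_trichotomy a 0 with ha | rfl | ha
  · simp [entryProb_of_neg ξ ha]
  · exact (entryProb_zero ξ).le
  have key : ∀ N : ℕ, ∀ b : ℤ, ∑ n ∈ Finset.range N, entryWeight ξ n b ≤ 1 := by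
    intro N
    induction N with
    | zero => simp
    | succ N ih =>
      intro b
      rcases le_or_gt b 0 with hb | hb
      · rw [Finset.sum_range_succ']
        simp only [entryWeight, hb.not_gt, if_false, Finset.sum_const_zero, zero_add]
        split_ifs <;> simp
      · rw [sum_range_succ_entryWeight ξ N hb, ← tsum_step ξ b]
        exact ENNReal.tsum_le_tsum fun w => mul_le_of_le_one_right' (ih w)
  exact ENNReal.tsum_le_of_sum_range_le fun N => key N a

/-- A visit to `z` before the entrance into `(-∞, 0]` happens either before the entrance into
`(-∞, 1]`, or after it; in the latter case this entrance takes place at `1`. -/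
theorem green_le_shift (ξ : Measure ℤ) (y z : ℤ) :
    green ξ y z ≤ green ξ (y - 1) (z - 1) + entryProb ξ (y - 1) * green ξ 1 z := by
  have key : ∀ N : ℕ, ∀ y : ℤ, ∑ n ∈ Finset.range N, stayWeight ξ n y z ≤
      green ξ (y - 1) (z - 1) + entryProb ξ (y - 1) * green ξ 1 z := by
    intro N
    induction N with
    | zero => simp
    | succ N ih =>
      intro y
      rcases lt_trichotomy y 1 with hy | rfl | hy
      · simp [stayWeight_eq_zero_of_start_nonpos ξ _ (show y ≤ 0 by lia)]
      · simp only [sub_self, entryProb_zero, one_mul]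
        exact le_add_left (ENNReal.sum_le_tsum _)
      · have hy0 : 0 < y := by lia
        have hy1 : 0 < y - 1 := by lia
        have shift : ∀ f : ℤ → ℝ≥0∞, ∑' w, ξ {w - (y - 1)} * f w =
            ∑' w, ξ {w - y} * f (w - 1) := fun f => by
          rw [← (Equiv.subRight (1 : ℤ)).tsum_eq]
          simp
        calc ∑ n ∈ Finset.range (N + 1), stayWeight ξ n y z
            = (∑' w, ξ {w - y} * ∑ n ∈ Finset.range N, stayWeight ξ n w z)
                + (if y = z then 1 else 0) := by
              rw [Finset.sum_range_succ']
              simp only [stayWeight, hy0, true_and, if_true, Finset.mul_sum]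
              rw [Summable.tsum_finsetSum fun _ _ => ENNReal.summable]
          _ ≤ (∑' w, ξ {w - y} *
                (green ξ (w - 1) (z - 1) + entryProb ξ (w - 1) * green ξ 1 z))
                + (if y = z then 1 else 0) := by
              gcongr with w
              exact ih w
          _ = green ξ (y - 1) (z - 1) + entryProb ξ (y - 1) * green ξ 1 z := by
              rw [green_eq ξ hy1, entryProb_of_pos ξ hy1, shift, shift,
                ← ENNReal.tsum_mul_right]
              simp only [mul_add, ENNReal.tsum_add, sub_left_inj, mul_assoc]
              ring
  exact ENNReal.tsum_le_of_sum_range_le fun N => key N y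

theorem green_one_le {ξ : Measure ℤ} [IsProbabilityMeasure ξ] (hsymm : IsSymmetric ξ) (z : ℤ) :
    green ξ 1 z ≤ green ξ 1 1 := by
  rw [green_comm hsymm]
  refine (green_le_shift ξ z 1).trans ?_
  rw [sub_self, green_eq_zero_of_end_nonpos hsymm _ le_rfl, zero_add]
  exact mul_le_of_le_one_left' (entryProb_le_one ξ _)

/-- Summing `green_le_shift` over the levels `1, …, z` amounts to decomposing the paths from `y` to
`z` according to their minimum. -/
theorem green_le_sum {ξ : Measure ℤ} [IsProbabilityMeasure ξ] (hsymm : IsSymmetric ξ) (y : ℤ)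
    (z : ℕ) :
    green ξ y z ≤ green ξ 1 1 * ∑ m ∈ Finset.range z, entryProb ξ (y - (m + 1)) := by
  induction z generalizing y with
  | zero => simp [green_eq_zero_of_end_nonpos hsymm]
  | succ z ih =>
    refine (green_le_shift ξ y _).trans ?_
    rw [Finset.sum_range_succ', mul_add]
    refine add_le_add ?_ ?_
    · have h := ih (y - 1)
      push_cast
      rw [add_sub_cancel_right]
      refine h.trans (le_of_eq ?_)
      congr 1
      refine Finset.sum_congr rfl fun m _ => ?_
      congr 1
      ring
    · rw [mul_comm]
      simp only [Nat.cast_zero, zero_add]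
      gcongr
      exact green_one_le hsymm _

/-- The probability that the walk started at `y > 0` ever enters `(-∞, 0]`, written as a sum over
the last point visited before the entrance. -/
noncomputable def exitProb (ξ : Measure ℤ) (y : ℤ) : ℝ≥0∞ :=
  ∑' z, green ξ y z * ξ (Set.Iic (-z))

theorem exitProb_eq (ξ : Measure ℤ) {y : ℤ} (hy : 0 < y) :
    exitProb ξ y = ξ (Set.Iic (-y)) + ∑' w, ξ {w - y} * exitProb ξ w := by
  simp only [exitProb, green_eq ξ hy, add_mul, ENNReal.tsum_add, ← ENNReal.tsum_mul_left,
    ← ENNReal.tsum_mul_right]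
  congr 1
  · rw [tsum_eq_single y fun z hz => by simp [hz.symm]]
    simp
  · rw [ENNReal.tsum_comm]
    simp only [mul_assoc]

theorem measure_Iic_neg_eq_tsum (ξ : Measure ℤ) (y : ℤ) :
    ξ (Set.Iic (-y)) = ∑' w, ξ {w - y} * if w ≤ 0 then 1 else 0 := by
  rw [← lintegral_indicator_one measurableSet_Iic, lintegral_countable',
    ← (Equiv.subRight y).tsum_eq]
  refine tsum_congr fun w => ?_
  simp [Set.indicator_apply, mul_comm]

theorem exitProb_le_one (ξ : Measure ℤ) [IsProbabilityMeasure ξ] (y : ℤ) :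
    exitProb ξ y ≤ 1 := by
  have key : ∀ N : ℕ, ∀ y : ℤ,
      ∑ n ∈ Finset.range N, ∑' z, stayWeight ξ n y z * ξ (Set.Iic (-z)) ≤
        if 0 < y then 1 else 0 := by
    intro N
    induction N with
    | zero => simp
    | succ N ih =>
      intro y
      split_ifs with hy
      · rw [Finset.sum_range_succ']
        calc _ = (∑' w, ξ {w - y} * ∑ n ∈ Finset.range N,
                ∑' z, stayWeight ξ n w z * ξ (Set.Iic (-z))) + ξ (Set.Iic (-y)) := by
              congr 1
              · simp only [stayWeight, hy, if_true, Finset.mul_sum]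
                rw [Summable.tsum_finsetSum fun _ _ => ENNReal.summable]
                refine Finset.sum_congr rfl fun n _ => ?_
                simp only [← ENNReal.tsum_mul_left, ← ENNReal.tsum_mul_right]
                rw [ENNReal.tsum_comm]
                simp only [mul_assoc]
              · rw [tsum_eq_single y fun z hz => by simp [stayWeight, hz.symm]]
                simp [stayWeight, hy]
          _ ≤ (∑' w, ξ {w - y} * if 0 < w then 1 else 0) +
                ∑' w, ξ {w - y} * if w ≤ 0 then 1 else 0 := by
              rw [measure_Iic_neg_eq_tsum]
              gcongr with w
              exact ih w
          _ = 1 := by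
              rw [← ENNReal.tsum_add]
              refine Eq.trans (tsum_congr fun w => ?_) (tsum_step ξ y)
              by_cases hw : 0 < w
              · simp [hw, hw.not_ge]
              · simp [hw, not_lt.mp hw]
      · simp [stayWeight_eq_zero_of_start_nonpos ξ _ (not_lt.mp hy)]
  have : exitProb ξ y = ∑' n, ∑' z, stayWeight ξ n y z * ξ (Set.Iic (-z)) := by
    simp only [exitProb, green, ← ENNReal.tsum_mul_right]
    rw [ENNReal.tsum_comm]
  rw [this]
  refine ENNReal.tsum_le_of_sum_range_le fun N => (key N y).trans ?_
  split_ifs <;> simp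

/-- Each visit to `1` has a fixed chance of being the last one before the entrance into
`(-∞, 0]`. -/
theorem green_one_one_lt_top {ξ : Measure ℤ} [IsProbabilityMeasure ξ]
    (h : 0 < ξ (Set.Iic (-1))) : green ξ 1 1 < ∞ := by
  have h1 : green ξ 1 1 * ξ (Set.Iic (-1)) ≤ 1 :=
    (ENNReal.le_tsum (f := fun z => green ξ 1 z * ξ (Set.Iic (-z))) 1).trans (exitProb_le_one ξ 1)
  by_contra hG
  rw [not_lt, top_le_iff] at hG
  rw [hG, ENNReal.top_mul h.ne'] at h1
  simp at h1

/-- The tail sums of a square-integrable step. -/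
theorem tsum_mul_measure_Iic_lt_top {ξ : Measure ℤ} (hvar : HasFiniteVariance ξ) :
    ∑' n : ℕ, (n : ℝ≥0∞) * ξ (Set.Iic (-(n : ℤ))) < ∞ := by
  have hsq : ∑' k : ℤ, ENNReal.ofReal ((k : ℝ) ^ 2) * ξ {k} < ∞ := by
    have h := hvar.lintegral_lt_top
    rwa [lintegral_countable'] at h
  refine lt_of_le_of_lt ?_ hsq
  have hF : ∀ n : ℕ, ξ (Set.Iic (-(n : ℤ))) =
      ∑' k : ℤ, (if k ≤ -n then 1 else 0) * ξ {k} := fun n => by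
    rw [← lintegral_indicator_one measurableSet_Iic, lintegral_countable']
    exact tsum_congr fun k => by simp [Set.indicator_apply]
  simp only [hF, ← ENNReal.tsum_mul_left]
  rw [ENNReal.tsum_comm]
  refine ENNReal.tsum_le_tsum fun k => ?_
  simp only [← mul_assoc, ENNReal.tsum_mul_right]
  gcongr
  rw [tsum_eq_sum (s := Finset.range (k.natAbs + 1)) fun n hn => by
    rw [if_neg, mul_zero]
    simp only [Finset.mem_range] at hn
    lia]
  calc ∑ n ∈ Finset.range (k.natAbs + 1), (n : ℝ≥0∞) * (if k ≤ -n then 1 else 0)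
      ≤ ∑ n ∈ Finset.range (k.natAbs + 1), (n : ℝ≥0∞) := by
        gcongr with n
        split_ifs <;> simp
    _ ≤ ((k.natAbs ^ 2 : ℕ) : ℝ≥0∞) := by
        rw [← Nat.cast_sum]
        gcongr
        induction k.natAbs with
        | zero => simp
        | succ m ih =>
          rw [Finset.sum_range_succ]
          nlinarith
    _ = ENNReal.ofReal ((k : ℝ) ^ 2) := by
        rw [← ENNReal.ofReal_natCast]
        congr 1
        push_cast
        rw [← sq_abs (k : ℝ), Nat.cast_natAbs]
        simp

end Green

/-! ### The law of the walk and its hitting events -/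

section Walk


/-- The sequence of steps which starts with `k` and goes on with `s`. -/
def consStep (k : ℤ) (s : ℕ → ℤ) : ℕ → ℤ
  | 0 => k
  | i + 1 => s i

instance (ξ : Measure ℤ) [IsProbabilityMeasure ξ] : IsProbabilityMeasure (stepLaw ξ) :=
  inferInstanceAs (IsProbabilityMeasure (Measure.infinitePi fun _ : ℕ => ξ))

theorem walk_zero (y : ℤ) (s : ℕ → ℤ) : walk y s 0 = y := by simp [walk]

theorem walk_succ (y : ℤ) (s : ℕ → ℤ) (n : ℕ) : walk y s (n + 1) = walk y s n + s n := by
  simp [walk, Finset.sum_range_succ, add_assoc]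

theorem walk_consStep_succ (y k : ℤ) (s : ℕ → ℤ) (n : ℕ) :
    walk y (consStep k s) (n + 1) = walk (y + k) s n := by
  rw [walk, walk, Finset.sum_range_succ']
  simp only [consStep]
  ring

theorem measurable_walk (y : ℤ) (n : ℕ) : Measurable fun s : ℕ → ℤ => walk y s n := by
  unfold walk
  fun_prop

theorem measurable_consStep : Measurable fun q : ℤ × (ℕ → ℤ) => consStep q.1 q.2 := by
  rw [measurable_pi_iff]
  rintro (_ | i)
  · exact measurable_fst
  · exact (measurable_pi_apply i).comp measurable_snd

/-- A first step and an independent sequence of steps make up a sequence of independent steps. -/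
theorem map_consStep (ξ : Measure ℤ) [IsProbabilityMeasure ξ] :
    (ξ.prod (stepLaw ξ)).map (fun q => consStep q.1 q.2) = stepLaw ξ := by
  refine Measure.eq_infinitePi _ fun s t ht => ?_
  obtain ⟨N, hN⟩ := s.exists_nat_subset_range
  have hs : s ⊆ Finset.range (N + 1) := hN.trans (Finset.range_mono (Nat.le_succ N))
  classical
  -- enlarging the index set to an initial segment, with trivial constraints at the new indices
  set t' : ℕ → Set ℤ := fun i => if i ∈ s then t i else Set.univ with ht'
  have hprod : ∏ i ∈ s, ξ (t i) = ∏ i ∈ Finset.range (N + 1), ξ (t' i) := by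
    rw [← Finset.prod_subset hs fun i _ hi => by simp [ht', hi]]
    exact Finset.prod_congr rfl fun i hi => by simp [ht', hi]
  have hpre : (fun q : ℤ × (ℕ → ℤ) => consStep q.1 q.2) ⁻¹' Set.pi s t =
      t' 0 ×ˢ Set.pi (Finset.range N) fun i => t' (i + 1) := by
    ext ⟨k, x⟩
    simp only [Set.mem_preimage, Set.mem_pi, Finset.mem_coe, Set.mem_prod, Finset.mem_range, ht']
    constructor
    · intro h
      refine ⟨?_, fun i _ => ?_⟩
      · split_ifs with h0
        · exact h 0 h0
        · trivial
      · split_ifs with hi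
        · exact h (i + 1) hi
        · trivial
    · rintro ⟨h0, h⟩ (_ | i) hi
      · simpa only [hi, if_true, consStep] using h0
      · have := h i (by have := Finset.mem_range.1 (hs hi); lia)
        simpa only [hi, if_true, consStep] using this
  rw [Measure.map_apply measurable_consStep
    (MeasurableSet.pi s.countable_toSet fun i _ => ht i), hpre, Measure.prod_prod, stepLaw,
    Measure.infinitePi_pi _ fun i _ => .of_discrete, hprod, Finset.prod_range_succ', mul_comm]

/-- The Markov property at time `1`. -/
theorem stepLaw_eq_tsum (ξ : Measure ℤ) [IsProbabilityMeasure ξ] {E : Set (ℕ → ℤ)}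
    (hE : MeasurableSet E) (y : ℤ) :
    stepLaw ξ E = ∑' w, ξ {w - y} * stepLaw ξ {s | consStep (w - y) s ∈ E} := by
  conv_lhs => rw [← map_consStep ξ]
  rw [Measure.map_apply measurable_consStep hE,
    Measure.prod_apply (measurable_consStep hE), lintegral_countable',
    ← (Equiv.subRight y).tsum_eq]
  exact tsum_congr fun w => mul_comm _ _

theorem stepLaw_map_neg {ξ : Measure ℤ} [IsProbabilityMeasure ξ] (hsymm : IsSymmetric ξ) :
    (stepLaw ξ).map (fun s i => -s i) = stepLaw ξ := by
  have hneg : ξ.map (fun k => -k) = ξ := by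
    refine Measure.ext_of_singleton fun k => ?_
    rw [Measure.map_apply .of_discrete .of_discrete, ← hsymm k]
    congr 1
    ext j
    simp
  refine Measure.eq_infinitePi _ fun s t ht => ?_
  rw [Measure.map_apply (by fun_prop) (MeasurableSet.pi s.countable_toSet fun i _ => ht i)]
  have : (fun (x : ℕ → ℤ) i => -x i) ⁻¹' Set.pi s t =
      Set.pi s fun i => (fun k : ℤ => -k) ⁻¹' t i := rfl
  rw [this, stepLaw, Measure.infinitePi_pi _ fun i _ => .of_discrete]
  refine Finset.prod_congr rfl fun i _ => ?_
  rw [← Measure.map_apply .of_discrete .of_discrete, hneg]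

/-- Almost surely the walk makes a step of length more than `m`. -/
theorem ae_exists_long_step {ξ : Measure ℤ} [IsProbabilityMeasure ξ]
    (hlong : HasUnboundedSteps ξ) (m : ℕ) : ∀ᵐ s ∂stepLaw ξ, ∃ i, (m : ℤ) < |s i| := by
  set B : Set ℤ := {k | (m : ℤ) < |k|}
  have hB : ξ Bᶜ < 1 := by
    rw [prob_compl_eq_one_sub .of_discrete]
    exact ENNReal.sub_lt_self (by simp) (by simp) (hlong m).ne'
  rw [ae_iff]
  refine le_antisymm (ge_of_tendsto' (ENNReal.tendsto_pow_atTop_nhds_zero_of_lt_one hB)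
    fun n => ?_) zero_le
  calc stepLaw ξ {s | ¬∃ i, (m : ℤ) < |s i|}
      ≤ stepLaw ξ (Set.pi (Finset.range n) fun _ => Bᶜ) := by
        refine measure_mono fun s hs i _ => ?_
        simp only [not_exists, Set.mem_ofPred_eq] at hs
        exact hs i
    _ = ξ Bᶜ ^ n := by
        rw [stepLaw, Measure.infinitePi_pi _ fun i _ => .of_discrete]
        simp

/-- A step longer than `2 y` takes the walk out of `[-y, y]`, and by symmetry each side is equally
likely. -/
theorem half_le_stepLaw_exists_nonpos {ξ : Measure ℤ} [IsProbabilityMeasure ξ]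
    (hsymm : IsSymmetric ξ) (hlong : HasUnboundedSteps ξ) (y : ℤ) :
    2⁻¹ ≤ stepLaw ξ {s | ∃ n, walk y s n ≤ 0} := by
  set E : Set (ℕ → ℤ) := {s | ∃ n, walk y s n ≤ 0} with hE
  have hEm : MeasurableSet E := by
    rw [hE, Set.ofPred_exists]
    exact MeasurableSet.iUnion fun n => measurable_walk y n measurableSet_Iic
  have hcover : stepLaw ξ (E ∪ (fun s i => -s i) ⁻¹' E) = 1 := by
    rw [← measure_univ (μ := stepLaw ξ)]
    refine measure_congr (eventuallyEq_univ.2 ?_)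
    filter_upwards [ae_exists_long_step hlong (2 * y.natAbs)] with s ⟨i, hi⟩
    by_contra hs
    simp only [hE, Set.mem_union, Set.mem_preimage, Set.mem_ofPred_eq, not_or, not_exists,
      not_le] at hs
    have hneg : ∀ n, walk y (fun i => -s i) n = 2 * y - walk y s n := fun n => by
      simp only [walk, Finset.sum_neg_distrib]
      ring
    have h1 := hs.1 i
    have h2 := hs.1 (i + 1)
    have h3 := hs.2 i
    have h4 := hs.2 (i + 1)
    rw [hneg] at h3 h4
    rw [walk_succ] at h2 h4
    push_cast at hi
    have h5 := le_abs_self y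
    rcases lt_abs.1 hi with hi | hi <;> lia
  have hflip : stepLaw ξ ((fun s i => -s i) ⁻¹' E) = stepLaw ξ E := by
    conv_rhs => rw [← stepLaw_map_neg hsymm]
    rw [Measure.map_apply (by fun_prop) hEm]
  have h := measure_union_le (μ := stepLaw ξ) E ((fun s i => -s i) ⁻¹' E)
  rw [hcover, hflip, ← two_mul] at h
  rwa [ENNReal.inv_le_iff_le_mul (by simp) (by simp)]

theorem stepLaw_exists_nonpos_le_exitProb (ξ : Measure ℤ) [IsProbabilityMeasure ξ] {y : ℤ}
    (hy : 0 < y) : stepLaw ξ {s | ∃ n, walk y s n ≤ 0} ≤ exitProb ξ y := by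
  have key : ∀ N : ℕ, ∀ y : ℤ, stepLaw ξ {s | ∃ n ≤ N, walk y s n ≤ 0} ≤
      (if y ≤ 0 then 1 else 0) + exitProb ξ y := by
    intro N
    induction N with
    | zero =>
      intro y
      by_cases hy : y ≤ 0 <;> simp [walk_zero, hy]
    | succ N ih =>
      intro y
      by_cases hy : y ≤ 0
      · simp only [hy, if_true]
        exact prob_le_one.trans le_self_add
      · have hm : MeasurableSet {s : ℕ → ℤ | ∃ n ≤ N + 1, walk y s n ≤ 0} := by
          simp only [Set.ofPred_exists, ← exists_prop]
          exact MeasurableSet.iUnion fun n => MeasurableSet.iUnion fun _ =>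
            measurable_walk y n measurableSet_Iic
        rw [stepLaw_eq_tsum ξ hm y, if_neg hy, zero_add, exitProb_eq ξ (not_le.1 hy),
          measure_Iic_neg_eq_tsum, ← ENNReal.tsum_add]
        refine ENNReal.tsum_le_tsum fun w => ?_
        rw [← mul_add]
        gcongr
        refine (measure_mono ?_).trans (ih w)
        rintro s ⟨_ | n, hn, hs⟩
        · simp [walk_zero, hy] at hs
        · rw [walk_consStep_succ, add_sub_cancel] at hs
          exact ⟨n, by lia, hs⟩
  have hU : {s : ℕ → ℤ | ∃ n, walk y s n ≤ 0} = ⋃ N, {s | ∃ n ≤ N, walk y s n ≤ 0} := by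
    ext s
    simp only [Set.mem_ofPred_eq, Set.mem_iUnion]
    exact ⟨fun ⟨n, hn⟩ => ⟨n, n, le_rfl, hn⟩, fun ⟨_, n, _, hn⟩ => ⟨n, hn⟩⟩
  have hmono : Monotone fun N : ℕ => {s : ℕ → ℤ | ∃ n ≤ N, walk y s n ≤ 0} :=
    fun _ _ hab _ ⟨n, hn, h⟩ => ⟨n, hn.trans hab, h⟩
  rw [hU, hmono.measure_iUnion]
  exact iSup_le fun N => by simpa [hy.not_ge] using key N y

theorem HasUnboundedSteps.exists_pos_singleton {ξ : Measure ℤ} (hsymm : IsSymmetric ξ)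
    (hlong : HasUnboundedSteps ξ) (m : ℕ) : ∃ k : ℕ, m < k ∧ 0 < ξ {-(k : ℤ)} := by
  by_contra! h
  refine (hlong m).ne' ?_
  rw [measure_null_iff_singleton (Set.to_countable _)]
  intro k hk
  simp only [Set.mem_ofPred_eq] at hk
  have := h k.natAbs (by rwa [Int.abs_eq_natAbs, Nat.cast_lt] at hk)
  rcases Int.natAbs_eq k with hk' | hk'
  · rw [hk', ← hsymm]
    exact nonpos_iff_eq_zero.1 this
  · rw [hk']
    exact nonpos_iff_eq_zero.1 this

/-- From infinity, the half-line is entered without overshoot with a probability that does not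
vanish. If it did, the Green function `green ξ y z` would tend to `0` as `y → ∞` for each `z`; since
it is at most a constant times `z`, which is summable against the tail of a square-integrable step,
the probability of ever entering the half-line would tend to `0`. -/
theorem exists_frequently_le_entryProb {ξ : Measure ℤ} [IsProbabilityMeasure ξ]
    (hsymm : IsSymmetric ξ) (hvar : HasFiniteVariance ξ) (hlong : HasUnboundedSteps ξ) :
    ∃ c : ℝ≥0∞, 0 < c ∧ ∃ᶠ y : ℤ in atTop, c ≤ entryProb ξ y := by
  by_contra! hcon
  have hu : Tendsto (entryProb ξ) atTop (𝓝 0) := by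
    rw [ENNReal.tendsto_nhds_zero]
    intro ε hε
    exact (hcon ε hε).mono fun y hy => hy.le
  have hC : green ξ 1 1 < ∞ := by
    refine green_one_one_lt_top ?_
    obtain ⟨k, hk, hpos⟩ := hlong.exists_pos_singleton hsymm 0
    refine hpos.trans_le (measure_mono ?_)
    simp only [Set.singleton_subset_iff, Set.mem_Iic]
    lia
  -- the sum over all integers reduces to a sum over the natural numbers
  have hexit : ∀ y : ℤ, exitProb ξ y = ∑' z : ℕ, green ξ y z * ξ (Set.Iic (-(z : ℤ))) := by
    intro y
    refine (Function.Injective.tsum_eq Nat.cast_injective ?_).symm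
    intro z hz
    by_contra hz'
    refine hz ?_
    have hz0 : z ≤ 0 := by
      by_contra! hpos
      exact hz' ⟨z.toNat, by simp [hpos.le]⟩
    simp [green_eq_zero_of_end_nonpos hsymm y hz0]
  have hlim : Tendsto (fun n : ℕ => exitProb ξ (n : ℤ)) atTop (𝓝 0) := by
    have h := tendsto_lintegral_of_dominated_convergence
      (μ := Measure.count) (F := fun (n z : ℕ) => green ξ n z * ξ (Set.Iic (-(z : ℤ))))
      (f := fun _ => 0) (fun z : ℕ => green ξ 1 1 * (z * ξ (Set.Iic (-(z : ℤ)))))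
      (fun n => .of_discrete) ?_ ?_ ?_
    · simpa only [lintegral_count, ← hexit, tsum_zero] using h
    · refine fun n => ae_of_all _ fun z => ?_
      simp only
      rw [← mul_assoc]
      gcongr
      refine (green_le_sum hsymm n z).trans ?_
      gcongr
      refine (Finset.sum_le_sum fun m _ => entryProb_le_one ξ _).trans ?_
      simp
    · rw [lintegral_count, ENNReal.tsum_mul_left]
      exact (ENNReal.mul_lt_top hC (tsum_mul_measure_Iic_lt_top hvar)).ne
    · refine ae_of_all _ fun z => ?_
      have hsum : Tendsto (fun n : ℕ => green ξ 1 1 *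
          ∑ m ∈ Finset.range z, entryProb ξ ((n : ℤ) - (m + 1))) atTop (𝓝 0) := by
        have : Tendsto (fun n : ℕ => ∑ m ∈ Finset.range z, entryProb ξ ((n : ℤ) - (m + 1)))
            atTop (𝓝 (∑ m ∈ Finset.range z, 0)) :=
          tendsto_finsetSum _ fun m _ =>
            hu.comp (by
            simpa only [sub_eq_add_neg] using
              tendsto_atTop_add_const_right _ (-((m : ℤ) + 1)) tendsto_natCast_atTop_atTop)
        have h := ENNReal.Tendsto.const_mul (a := green ξ 1 1) this (Or.inr hC.ne)
        simpa using h
      have hG : Tendsto (fun n : ℕ => green ξ n z) atTop (𝓝 0) :=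
        tendsto_of_tendsto_of_tendsto_of_le_of_le tendsto_const_nhds hsum (fun _ => zero_le)
          fun n => green_le_sum hsymm n z
      have h := ENNReal.Tendsto.mul_const (b := ξ (Set.Iic (-(z : ℤ)))) hG
        (Or.inr (measure_ne_top _ _))
      simpa using h
  have hhalf : (2⁻¹ : ℝ≥0∞) ≤ 0 := by
    refine ge_of_tendsto hlim ?_
    filter_upwards [eventually_gt_atTop 0] with n hn
    exact (half_le_stepLaw_exists_nonpos hsymm hlong n).trans
      (stepLaw_exists_nonpos_le_exitProb ξ (by exact_mod_cast hn))
  simp at hhalf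

/-- The path `x` with `x 0 = v` and `x 1 = w`. -/
def gluing (v w : ℤ) : ℕ → ℤ := fun i => if i = 0 then v else w

theorem measurableSet_hittingEvent (A : Finset ℤ) (y : ℤ) (m : ℕ) (x : ℕ → ℤ) :
    MeasurableSet (hittingEvent A y m x) := by
  have h : ∀ (n : ℕ) (S : Set ℤ), MeasurableSet {s : ℕ → ℤ | walk y s n ∈ S} := fun n S =>
    measurable_walk y n .of_discrete
  unfold hittingEvent IsHittingTime
  refine measurableSet_setOfPred.2 (Measurable.exists fun T => ?_)
  refine (Measurable.and (measurable_const.and (Measurable.and ?_ ?_)) (measurable_const.and ?_))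
  · exact measurableSet_setOfPred.1 (h T A)
  · refine Measurable.forall fun k => measurable_const.imp (measurable_const.imp ?_)
    exact measurableSet_setOfPred.1 (h k {a | a ∉ A})
  · refine Measurable.forall fun i => measurable_const.imp ?_
    exact measurableSet_setOfPred.1 (h (T - i) {x i})

/-- If the walk enters `(-∞, w]` at `w`, to the right of `A`, and then jumps to `v ∈ A`, then `v` is
hit from `w`. -/
theorem entryProb_mul_le_stepLaw_hittingEvent (ξ : Measure ℤ) [IsProbabilityMeasure ξ]
    {A : Finset ℤ} {v w : ℤ} (hv : v ∈ A) (hw : ∀ a ∈ A, a < w) {y : ℤ} (hy : w ≤ y) :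
    entryProb ξ (y - w) * ξ {v - w} ≤ stepLaw ξ (hittingEvent A y 1 (gluing v w)) := by
  have key : ∀ N : ℕ, ∀ y : ℤ, w ≤ y →
      (∑ n ∈ Finset.range N, entryWeight ξ n (y - w)) * ξ {v - w} ≤
        stepLaw ξ (hittingEvent A y 1 (gluing v w)) := by
    intro N
    induction N with
    | zero => simp
    | succ N ih =>
      intro y hy
      rw [stepLaw_eq_tsum ξ (measurableSet_hittingEvent A y 1 (gluing v w)) y]
      rcases hy.eq_or_lt with rfl | hy
      · refine le_trans ?_ (ENNReal.le_tsum v)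
        have hall : {s | consStep (v - w) s ∈ hittingEvent A w 1 (gluing v w)} = Set.univ := by
          refine Set.eq_univ_of_forall fun s => ⟨1, ⟨one_pos, ?_, ?_⟩, le_rfl, fun i hi => ?_⟩
          · rw [walk_consStep_succ, walk_zero]
            simpa using hv
          · intro k hk hk'
            lia
          · interval_cases i
            · simp [walk_consStep_succ, walk_zero, gluing]
            · simp [walk_zero, gluing]
        rw [hall, measure_univ, mul_one, sub_self]
        exact mul_le_of_le_one_left' ((ENNReal.sum_le_tsum _).trans (entryProb_le_one ξ 0))
      · rw [sum_range_succ_entryWeight ξ N (sub_pos.2 hy), ← ENNReal.tsum_mul_right,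
          ← (Equiv.subRight w).tsum_eq]
        refine ENNReal.tsum_le_tsum fun z => ?_
        simp only [Equiv.subRight_apply, sub_sub_sub_cancel_right]
        rw [mul_assoc]
        gcongr
        rcases lt_or_ge z w with hz | hz
        · have h0 : ∑ n ∈ Finset.range N, entryWeight ξ n (z - w) = 0 := by
            refine le_antisymm ((ENNReal.sum_le_tsum _).trans ?_) zero_le
            exact (entryProb_of_neg ξ (sub_neg.2 hz)).le
          simp [h0]
        · refine (ih z hz).trans (measure_mono ?_)
          rintro s ⟨T, ⟨hT0, hTA, hT⟩, hmT, hx⟩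
          refine ⟨T + 1, ⟨T.succ_pos, ?_, ?_⟩, by lia, fun i hi => ?_⟩
          · rwa [walk_consStep_succ, add_sub_cancel]
          · rintro (_ | k) hk hkT
            · lia
            · rw [walk_consStep_succ, add_sub_cancel]
              rcases k.eq_zero_or_pos with rfl | hk0
              · rw [walk_zero]
                exact fun hzA => (hw z hzA).not_ge hz
              · exact hT k hk0 (by lia)
          · rw [show T + 1 - i = (T - i) + 1 by lia, walk_consStep_succ, add_sub_cancel]
            exact hx i hi
  rw [entryProb, ← ENNReal.tsum_mul_right]
  refine ENNReal.tsum_le_of_sum_range_le fun N => ?_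
  rw [← Finset.sum_mul]
  exact key N y hy

theorem IsLimitPathLaw.le_cylinder {ξ : Measure ℤ} [IsProbabilityMeasure ξ] {A : Finset ℤ}
    {ν : Measure (ℕ → ℤ)} (hν : IsLimitPathLaw ξ A atTop ν) {c : ℝ≥0∞}
    (hc : ∃ᶠ y : ℤ in atTop, c ≤ entryProb ξ y) {v w : ℤ} (hv : v ∈ A) (hw : ∀ a ∈ A, a < w) :
    c * ξ {v - w} ≤ ν (cylinder 1 (gluing v w)) := by
  refine ge_of_tendsto_of_frequently (hν.tendsto 1 _) ?_
  have hshift : ∃ᶠ y : ℤ in atTop, c ≤ entryProb ξ (y - w) :=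
    (tendsto_atTop_add_const_right atTop w tendsto_id).frequently (by simpa using hc)
  refine (hshift.and_eventually (eventually_ge_atTop w)).mono fun y hy => ?_
  exact (mul_le_mul_left hy.1 _).trans (entryProb_mul_le_stepLaw_hittingEvent ξ hv hw hy.2)

end Walk

/-! ### Stars in the aggregation tree -/

section Tree

variable {Ω : Type*} {path : ℕ → Ω → ℕ → ℤ}

theorem measurable_history (path : ℕ → Ω → ℕ → ℤ) {n i : ℕ} (hi : i < n) :
    Measurable[history path n] (path i) := by
  rw [measurable_iff_comap_le]
  exact le_iSup₂_of_le i (Finset.mem_range.2 hi) le_rfl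

/-- An event which depends only on the points `Π_i(0)` and `Π_i(-1)` with `i ≤ n` belongs to the
history up to time `n`. -/
theorem measurableSet_history (path : ℕ → Ω → ℕ → ℤ) (n : ℕ) {D : Set Ω}
    (hD : ∀ ω ω', (∀ i < n, path i ω 0 = path i ω' 0 ∧ path i ω 1 = path i ω' 1) →
      ω ∈ D → ω' ∈ D) : MeasurableSet[history path n] D := by
  set X : Ω → Fin n → ℤ × ℤ := fun ω i => (path i ω 0, path i ω 1) with hX
  have hXm : Measurable[history path n] X := by
    let _ : MeasurableSpace Ω := history path n
    refine measurable_pi_iff.2 fun i => Measurable.prodMk ?_ ?_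
    · exact (measurable_pi_apply 0).comp (measurable_history path i.2)
    · exact (measurable_pi_apply 1).comp (measurable_history path i.2)
  have : D = X ⁻¹' (X '' D) := by
    refine (Set.subset_preimage_image X D).antisymm ?_
    rintro ω' ⟨ω, hω, hωω'⟩
    exact hD ω ω' (fun i hi => Prod.ext_iff.1 (congrFun hωω' ⟨i, hi⟩)) hω
  rw [this]
  exact hXm .of_discrete

theorem history_mono (path : ℕ → Ω → ℕ → ℤ) {m n : ℕ} (h : m ≤ n) :
    history path m ≤ history path n :=
  iSup₂_le fun i hi => le_iSup₂_of_le i (Finset.range_mono h hi) le_rfl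

/-- The event that `v` is the largest point of `A_n` and that the next `i` particles are glued to
`v`, from `v + j 0`, …, `v + j (i - 1)`. -/
def starAt (path : ℕ → Ω → ℕ → ℤ) (j : ℕ → ℕ) (n i : ℕ) (v : ℤ) : Set Ω :=
  {ω | IsGreatest (aggregate path n ω : Set ℤ) v ∧
    ∀ l < i, path (n + l) ω 0 = v ∧ path (n + l) ω 1 = v + j l}

theorem mem_aggregate {n : ℕ} {ω : Ω} {a : ℤ} :
    a ∈ aggregate path n ω ↔ a = 0 ∨ ∃ i < n, path i ω 1 = a := by
  simp [aggregate]

theorem aggregate_congr {n : ℕ} {ω ω' : Ω} (h : ∀ i < n, path i ω 1 = path i ω' 1) :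
    aggregate path n ω = aggregate path n ω' := by
  ext a
  simp only [mem_aggregate]
  exact or_congr_right (exists_congr fun i => and_congr_right fun hi => by rw [h i hi])

theorem aggregate_mono {m n : ℕ} (h : m ≤ n) (ω : Ω) :
    aggregate path m ω ⊆ aggregate path n ω := fun a ha => by
  rw [mem_aggregate] at ha ⊢
  exact ha.imp_right fun ⟨i, hi, h'⟩ => ⟨i, hi.trans_le h, h'⟩

theorem measurableSet_starAt (path : ℕ → Ω → ℕ → ℤ) (j : ℕ → ℕ) (n i : ℕ) (v : ℤ) :
    MeasurableSet[history path (n + i)] (starAt path j n i v) := by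
  refine measurableSet_history path (n + i) ?_
  rintro ω ω' h ⟨hv, hω⟩
  refine ⟨?_, fun l hl => ?_⟩
  · rwa [← aggregate_congr fun m hm => (h m (by lia)).2]
  · rw [← (h (n + l) (by lia)).1, ← (h (n + l) (by lia)).2]
    exact hω l hl

theorem starAt_succ (path : ℕ → Ω → ℕ → ℤ) (j : ℕ → ℕ) (n i : ℕ) (v : ℤ) :
    starAt path j n (i + 1) v =
      starAt path j n i v ∩ path (n + i) ⁻¹' cylinder 1 (gluing v (v + j i)) := by
  ext ω
  have hcyl : path (n + i) ω ∈ cylinder 1 (gluing v (v + j i)) ↔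
      path (n + i) ω 0 = v ∧ path (n + i) ω 1 = v + j i := by
    refine ⟨fun h => ⟨h 0 zero_le_one, h 1 le_rfl⟩, fun h m hm => ?_⟩
    interval_cases m
    exacts [h.1, h.2]
  simp only [starAt, Set.mem_inter_iff, Set.mem_preimage, hcyl, Set.mem_ofPred_eq,
    Nat.lt_succ_iff_lt_or_eq, or_imp, forall_and, forall_eq, and_assoc]
  tauto

theorem mem_aggregate_of_mem_starAt {j : ℕ → ℕ} {n i : ℕ} {v : ℤ} {ω : Ω}
    (h : ω ∈ starAt path j n i v) : v ∈ aggregate path (n + i) ω :=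
  aggregate_mono (Nat.le_add_right n i) ω h.1.1

/-- The gluing points of a star increase, so the next one lies to the right of the aggregate. -/
theorem lt_of_mem_starAt {j : ℕ → ℕ} (hj : StrictMono j) (hj0 : 0 < j 0) {n i : ℕ} {v : ℤ} {ω : Ω}
    (h : ω ∈ starAt path j n i v) {a : ℤ} (ha : a ∈ aggregate path (n + i) ω) :
    a < v + j i := by
  have hji : 0 < j i := hj0.trans_le (hj.monotone (Nat.zero_le i))
  have hold : ∀ b ∈ aggregate path n ω, b < v + j i := fun b hb => by
    have : b ≤ v := h.1.2 hb
    lia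
  rw [mem_aggregate] at ha
  rcases ha with rfl | ⟨m, hm, rfl⟩
  · exact hold 0 (mem_aggregate.2 (Or.inl rfl))
  · rcases lt_or_ge m n with hmn | hmn
    · exact hold _ (mem_aggregate.2 (Or.inr ⟨m, hmn, rfl⟩))
    · obtain ⟨l, rfl⟩ := Nat.exists_eq_add_of_le hmn
      have hl : l < i := by lia
      rw [(h.2 l hl).2]
      have := hj hl
      lia

/-- The event that the `k` particles after time `n` form a star around the largest point of
`A_n`. -/
def star (path : ℕ → Ω → ℕ → ℤ) (j : ℕ → ℕ) (n k : ℕ) : Set Ω :=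
  ⋃ v, starAt path j n k v

theorem measurableSet_star (path : ℕ → Ω → ℕ → ℤ) (j : ℕ → ℕ) (n k : ℕ) :
    MeasurableSet[history path (n + k)] (star path j n k) :=
  MeasurableSet.iUnion fun v => measurableSet_starAt path j n k v

theorem star_zero (path : ℕ → Ω → ℕ → ℤ) (j : ℕ → ℕ) (n : ℕ) : star path j n 0 = Set.univ := by
  refine Set.eq_univ_of_forall fun ω => Set.mem_iUnion.2 ?_
  have hne : (aggregate path n ω).Nonempty := ⟨0, mem_aggregate.2 (Or.inl rfl)⟩
  exact ⟨_, Finset.isGreatest_max' _ hne, fun l hl => absurd hl (Nat.not_lt_zero l)⟩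

theorem le_encard_neighborSet_of_mem_starAt {j : ℕ → ℕ} (hj : StrictMono j) (hj0 : 0 < j 0)
    {n k : ℕ} {v : ℤ} {ω : Ω} (h : ω ∈ starAt path j n k v) :
    v ∈ (limitTree path ω).verts ∧ (k : ℕ∞) ≤ ((limitTree path ω).neighborSet v).encard := by
  have hle : aggregationTree path (n + k) ω ≤ limitTree path ω :=
    le_iSup (aggregationTree path · ω) _
  have hv := mem_aggregate_of_mem_starAt h
  refine ⟨hle.1 hv, ?_⟩
  have hsub : (fun l : ℕ => v + (j l : ℤ)) '' (Finset.range k : Set ℕ) ⊆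
      (limitTree path ω).neighborSet v := by
    rintro _ ⟨l, hl, rfl⟩
    have hl : l < k := by simpa using hl
    have hjl : 0 < j l := hj0.trans_le (hj.monotone (Nat.zero_le l))
    obtain ⟨h0, h1⟩ := h.2 l hl
    refine hle.2 ⟨?_, hv, ?_, n + l, by lia, ?_⟩
    · simp only
      lia
    · exact mem_aggregate.2 (Or.inr ⟨n + l, by lia, h1⟩)
    · rw [h0, h1]
  refine le_trans (le_of_eq ?_) (Set.encard_le_encard hsub)
  rw [Function.Injective.encard_image]
  · rw [Set.encard_coe_eq_coe_finsetCard, Finset.card_range]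
  · intro a b hab
    exact hj.injective (by simpa using hab)

end Tree

/-! ### The conditional law of the next path -/

section CondLaw

theorem limitPathLaw_univ_le (ξ : Measure ℤ) [IsProbabilityMeasure ξ] (A : Finset ℤ)
    (l : Filter ℤ) : limitPathLaw ξ A l Set.univ ≤ 1 := by
  unfold limitPathLaw
  split_ifs with h
  · have := h.choose_spec.isProbabilityMeasure
    exact prob_le_one
  · simp

theorem isFiniteMeasure_pathLaw (ξ : Measure ℤ) [IsProbabilityMeasure ξ] (A : Finset ℤ) :
    IsFiniteMeasure (pathLaw ξ A) := by
  refine ⟨?_⟩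
  rw [pathLaw, Measure.smul_apply, Measure.add_apply, smul_eq_mul]
  exact ENNReal.mul_lt_top (by simp) (ENNReal.add_lt_top.2
    ⟨(limitPathLaw_univ_le ξ A _).trans_lt ENNReal.one_lt_top,
      (limitPathLaw_univ_le ξ A _).trans_lt ENNReal.one_lt_top⟩)

/-- As `P_∞` is the mean of two measures of mass at most `1`, it can only have mass `1` if both of
them are limit laws. -/
theorem exists_isLimitPathLaw_atTop {ξ : Measure ℤ} [IsProbabilityMeasure ξ] {A : Finset ℤ}
    (h : (pathLaw ξ A).real Set.univ = 1) : ∃ ν, IsLimitPathLaw ξ A atTop ν := by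
  by_contra hne
  have h1 : pathLaw ξ A Set.univ ≤ 2⁻¹ := by
    rw [pathLaw, limitPathLaw, dif_neg hne, zero_add, Measure.smul_apply, smul_eq_mul]
    exact mul_le_of_le_one_right' (limitPathLaw_univ_le ξ A _)
  have h2 := ENNReal.toReal_mono (by simp) h1
  rw [Measure.real] at h
  rw [h] at h2
  norm_num at h2

theorem le_pathLaw_cylinder {ξ : Measure ℤ} [IsProbabilityMeasure ξ] {A : Finset ℤ}
    (h : (pathLaw ξ A).real Set.univ = 1) {c : ℝ≥0∞}
    (hc : ∃ᶠ y : ℤ in atTop, c ≤ entryProb ξ y) {v w : ℤ} (hv : v ∈ A) (hw : ∀ a ∈ A, a < w) :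
    2⁻¹ * (c * ξ {v - w}) ≤ pathLaw ξ A (cylinder 1 (gluing v w)) := by
  obtain ⟨ν, hν⟩ := exists_isLimitPathLaw_atTop h
  rw [pathLaw, Measure.smul_apply, Measure.add_apply, limitPathLaw_eq hν, smul_eq_mul]
  gcongr
  exact (hν.le_cylinder hc hv hw).trans le_self_add

variable {Ω : Type*} {ξ : Measure ℤ} [IsProbabilityMeasure ξ] [MeasurableSpace Ω] {μ : Measure Ω}
  {path : ℕ → Ω → ℕ → ℤ}

theorem IsDLA.history_le (hpath : IsDLA ξ μ path) (n : ℕ) :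
    history path n ≤ ‹MeasurableSpace Ω› :=
  iSup₂_le fun i _ => (hpath.measurable i).comap_le

/-- Conditional probabilities of the sure event are `1`, so that the path laws which the process
uses have mass `1`. -/
theorem IsDLA.ae_pathLaw_univ [IsProbabilityMeasure μ] (hpath : IsDLA ξ μ path) (n : ℕ) :
    ∀ᵐ ω ∂μ, (pathLaw ξ (aggregate path n ω)).real Set.univ = 1 := by
  filter_upwards [hpath.condLaw n Set.univ MeasurableSet.univ] with ω hω
  rw [← hω, Set.preimage_univ, Set.indicator_univ, condExp_const (hpath.history_le n)]

/-- Given any event of the past on which `w` lies to the right of the aggregate, the next particle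
is glued to the point `v` of the aggregate from `w` with a probability bounded below in terms of
`v - w` only. -/
theorem IsDLA.le_measure_inter_gluing [IsProbabilityMeasure μ] (hpath : IsDLA ξ μ path) {c : ℝ≥0∞}
    (hc : ∃ᶠ y : ℤ in atTop, c ≤ entryProb ξ y) {n : ℕ} {v w : ℤ} {D : Set Ω}
    (hD : MeasurableSet[history path n] D) (hv : ∀ ω ∈ D, v ∈ aggregate path n ω)
    (hw : ∀ ω ∈ D, ∀ a ∈ aggregate path n ω, a < w) :
    2⁻¹ * (c * ξ {v - w}) * μ D ≤ μ (D ∩ path n ⁻¹' cylinder 1 (gluing v w)) := by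
  set S := cylinder 1 (gluing v w)
  have hS : MeasurableSet S := measurableSet_cylinder _ _
  have hD' : MeasurableSet D := hpath.history_le n D hD
  have hpre : MeasurableSet (path n ⁻¹' S) := hpath.measurable n hS
  have hc1 : c ≤ 1 := by
    obtain ⟨y, hy⟩ := hc.exists
    exact hy.trans (entryProb_le_one ξ y)
  set q := 2⁻¹ * (c * ξ {v - w}) with hq
  have hq_top : q ≠ ∞ :=
    ENNReal.mul_ne_top (by simp) (ENNReal.mul_ne_top (hc1.trans_lt ENNReal.one_lt_top).ne
      (measure_ne_top _ _))
  have hint : ∫ ω in D, (pathLaw ξ (aggregate path n ω)).real S ∂μ =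
      μ.real (D ∩ path n ⁻¹' S) := by
    rw [← setIntegral_congr_ae hD' ((hpath.condLaw n S hS).mono fun ω h _ => h),
      setIntegral_condExp (hpath.history_le n) ((integrable_const _).indicator hpre) hD,
      setIntegral_indicator hpre]
    simp
  have hle : q.toReal * μ.real D ≤ μ.real (D ∩ path n ⁻¹' S) := by
    rw [← hint, mul_comm, ← smul_eq_mul, ← setIntegral_const]
    refine setIntegral_mono_on_ae (integrable_const _).integrableOn ?_ hD' ?_
    · exact (integrable_condExp.congr (hpath.condLaw n S hS)).integrableOn
    · filter_upwards [hpath.ae_pathLaw_univ n] with ω hω hωD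
      have := isFiniteMeasure_pathLaw ξ (aggregate path n ω)
      exact ENNReal.toReal_mono (measure_ne_top _ _)
        (le_pathLaw_cylinder hω hc (hv ω hωD) (hw ω hωD))
  rw [Measure.real, Measure.real, ← ENNReal.toReal_mul] at hle
  exact (ENNReal.toReal_le_toReal (ENNReal.mul_ne_top hq_top (measure_ne_top _ _))
    (measure_ne_top _ _)).1 hle

theorem IsDLA.le_measure_inter_starAt [IsProbabilityMeasure μ] (hpath : IsDLA ξ μ path) {c : ℝ≥0∞}
    (hc : ∃ᶠ y : ℤ in atTop, c ≤ entryProb ξ y) {j : ℕ → ℕ} (hj : StrictMono j) (hj0 : 0 < j 0)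
    {n : ℕ} {B : Set Ω} (hB : MeasurableSet[history path n] B) (i : ℕ) (v : ℤ) :
    (∏ l ∈ Finset.range i, 2⁻¹ * (c * ξ {-(j l : ℤ)})) * μ (B ∩ starAt path j n 0 v) ≤
      μ (B ∩ starAt path j n i v) := by
  induction i with
  | zero => simp
  | succ i ih =>
    have h := hpath.le_measure_inter_gluing hc (n := n + i) (v := v) (w := v + j i)
      (D := B ∩ starAt path j n i v)
      (MeasurableSet.inter (history_mono path (Nat.le_add_right n i) B hB)
        (measurableSet_starAt path j n i v))
      (fun ω hω => mem_aggregate_of_mem_starAt hω.2)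
      (fun ω hω a ha => lt_of_mem_starAt hj hj0 hω.2 ha)
    rw [sub_add_cancel_left, Set.inter_assoc, ← starAt_succ] at h
    refine le_trans ?_ h
    rw [Finset.prod_range_succ, mul_comm (∏ l ∈ Finset.range i, _), mul_assoc]
    gcongr

theorem IsDLA.measure_inter_star (hpath : IsDLA ξ μ path) (j : ℕ → ℕ) {n : ℕ} {B : Set Ω}
    (hB : MeasurableSet[history path n] B) (i : ℕ) :
    μ (B ∩ star path j n i) = ∑' v, μ (B ∩ starAt path j n i v) := by
  rw [star, Set.inter_iUnion, measure_iUnion]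
  · intro v w hvw
    refine Set.disjoint_left.2 fun ω hv hw => hvw ?_
    exact hv.2.1.unique hw.2.1
  · exact fun v => (hpath.history_le n B hB).inter
      (hpath.history_le _ _ (measurableSet_starAt path j n i v))

theorem IsDLA.le_measure_inter_star [IsProbabilityMeasure μ] (hpath : IsDLA ξ μ path) {c : ℝ≥0∞}
    (hc : ∃ᶠ y : ℤ in atTop, c ≤ entryProb ξ y) {j : ℕ → ℕ} (hj : StrictMono j) (hj0 : 0 < j 0)
    {n : ℕ} {B : Set Ω} (hB : MeasurableSet[history path n] B) (k : ℕ) :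
    (∏ l ∈ Finset.range k, 2⁻¹ * (c * ξ {-(j l : ℤ)})) * μ B ≤ μ (B ∩ star path j n k) := by
  have h0 := hpath.measure_inter_star j hB 0
  rw [star_zero, Set.inter_univ] at h0
  rw [h0, hpath.measure_inter_star j hB k, ← ENNReal.tsum_mul_left]
  exact ENNReal.tsum_le_tsum fun v => hpath.le_measure_inter_starAt hc hj hj0 hB k v

theorem IsDLA.ae_exists_mem_star [IsProbabilityMeasure μ] (hpath : IsDLA ξ μ path) {c : ℝ≥0∞}
    (hc0 : 0 < c) (hc : ∃ᶠ y : ℤ in atTop, c ≤ entryProb ξ y) {j : ℕ → ℕ} (hj : StrictMono j) (hj0 : 0 < j 0)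
    (hpos : ∀ l, 0 < ξ {-(j l : ℤ)}) (k : ℕ) :
    ∀ᵐ ω ∂μ, ∃ n, ω ∈ star path j n k := by
  set q := ∏ l ∈ Finset.range k, 2⁻¹ * (c * ξ {-(j l : ℤ)}) with hq
  have hq0 : q ≠ 0 := Finset.prod_ne_zero_iff.2 fun l _ =>
    mul_ne_zero (by simp) (mul_ne_zero hc0.ne' (hpos l).ne')
  -- failure of the first `t` disjoint blocks of `k` particles
  set N : ℕ → Set Ω := fun t => {ω | ∀ s < t, ω ∉ star path j (s * k) k} with hN
  have hNm : ∀ t, MeasurableSet[history path (t * k)] (N t) := fun t => by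
    have : N t = ⋂ s ∈ Finset.range t, (star path j (s * k) k)ᶜ := by
      ext ω
      simp [hN]
    rw [this]
    refine Finset.measurableSet_biInter _ fun s hs => MeasurableSet.compl ?_
    refine history_mono path ?_ _ (measurableSet_star path j (s * k) k)
    rw [← Nat.succ_mul]
    exact Nat.mul_le_mul_right k (Finset.mem_range.1 hs)
  have hdecay : ∀ t, μ (N t) ≤ (1 - q) ^ t := by
    intro t
    induction t with
    | zero => simpa using prob_le_one
    | succ t ih =>
      have hsucc : N (t + 1) = N t \ star path j (t * k) k := by
        ext ω
        simp only [hN, Set.mem_ofPred_eq, Set.mem_sdiff, Nat.lt_succ_iff_lt_or_eq, or_imp,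
          forall_and, forall_eq]
      have hstar := hpath.history_le _ _ (measurableSet_star path j (t * k) k)
      calc μ (N (t + 1)) = μ (N t) - μ (N t ∩ star path j (t * k) k) := by
            rw [hsucc, ← Set.sdiff_self_inter, measure_sdiff Set.inter_subset_left
              ((hpath.history_le _ _ (hNm t)).inter hstar).nullMeasurableSet (measure_ne_top _ _)]
        _ ≤ μ (N t) - q * μ (N t) :=
            tsub_le_tsub_left (hpath.le_measure_inter_star hc hj hj0 (hNm t) k) _
        _ = (1 - q) * μ (N t) := by
            rw [ENNReal.sub_mul fun _ _ => measure_ne_top _ _, one_mul]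
        _ ≤ (1 - q) ^ (t + 1) := by
            rw [pow_succ']
            gcongr
  rw [ae_iff]
  have hlt : 1 - q < 1 := ENNReal.sub_lt_self (by simp) (by simp) hq0
  refine le_antisymm (ge_of_tendsto' (ENNReal.tendsto_pow_atTop_nhds_zero_of_lt_one hlt)
    fun t => le_trans (measure_mono ?_) (hdecay t)) zero_le
  intro ω hω s _ hs
  exact hω ⟨_, hs⟩

end CondLaw

end DLA

theorem mainTheorem8 (ξ : Measure ℤ) [IsProbabilityMeasure ξ]
    (hsymm : DLA.IsSymmetric ξ) (haper : DLA.IsAperiodic ξ) (hvar : DLA.HasFiniteVariance ξ)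
    (hlong : DLA.HasUnboundedSteps ξ)
    {Ω : Type*} [MeasurableSpace Ω] (μ : Measure Ω) [IsProbabilityMeasure μ]
    (path : ℕ → Ω → ℕ → ℤ) (hpath : DLA.IsDLA ξ μ path) :
    ∀ᵐ ω ∂μ, (⨆ v ∈ (DLA.limitTree path ω).verts,
      ((DLA.limitTree path ω).neighborSet v).encard) = ⊤ := by
  obtain ⟨c, hc0, hc⟩ := DLA.exists_frequently_le_entryProb hsymm hvar hlong
  obtain ⟨j, hj, hjpos⟩ := Nat.exists_strictMono_subsequence
    (P := fun k : ℕ => 0 < k ∧ 0 < ξ {-(k : ℤ)}) fun m => by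
      obtain ⟨k, hk, hpos⟩ := hlong.exists_pos_singleton hsymm m
      exact ⟨k, hk, by lia, hpos⟩
  have hstar : ∀ᵐ ω ∂μ, ∀ k, ∃ n, ω ∈ DLA.star path j n k :=
    ae_all_iff.2 fun k => hpath.ae_exists_mem_star hc0 hc hj (hjpos 0).1 (fun l => (hjpos l).2) k
  filter_upwards [hstar] with ω hω
  refine ENat.eq_top_iff_forall_ge.2 fun k => ?_
  obtain ⟨n, hn⟩ := hω k
  obtain ⟨v, hv⟩ := Set.mem_iUnion.1 hn
  obtain ⟨hmem, hdeg⟩ := DLA.le_encard_neighborSet_of_mem_starAt hj (hjpos 0).1 hv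
  exact le_iSup₂_of_le v hmem hdeg
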